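/- Let $p$ be a prime and let $G$ be a finite $p$-group. For an irreducible complex character $\chi$ of $G$, with kernel $\ker\chi=\{g\in G:\chi(g)=\chi(1)\}$, the codegree of $\chi$ is $|G:\ker\chi|/\chi(1)$; let $\mathrm{cod}(G)$ be the set of codegrees of all irreducible complex characters of $G$. The coclass of $G$ is $\log_p|G|-c$, where $c$ is the nilpotence class of $G$. (i) If $G$ has coclass $2$ and $|G|\ge p^5$, then $p^2\in\mathrm{cod}(G)$. (ii) If $G$ has coclass $3$ and $|G|\ge p^6$, then $p^2\in\mathrm{cod}(G)$. -/

import Mathlib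

noncomputable section

/-- `Irr(G)`: the complex irreducible characters of `G`, as functions `G → ℂ`. -/
def irreducibleCharacters (G : Type*) [Group G] : Set (G → ℂ) :=
  {χ | ∃ (n : ℕ) (ρ : Representation ℂ G (Fin n → ℂ)), ρ.IsIrreducible ∧ ρ.character = χ}

/-- The kernel of a character `χ`: the elements `g` with `χ(g) = χ(1)`. -/
def characterKernel {G : Type*} [Group G] (χ : G → ℂ) : Set G :=
  {g | χ g = χ 1}

/-- The codegree `|G : ker χ| / χ(1)` of a character `χ` of a finite group `G`. The division takes
place in `ℂ`, and the index of the kernel is written as `|G| / |ker χ|`. -/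
def codegree {G : Type*} [Group G] (χ : G → ℂ) : ℂ :=
  ((Nat.card G : ℂ) / (Nat.card (characterKernel χ) : ℂ)) / χ 1

/-- `cod(G)`: the set of codegrees of the irreducible characters of `G`. -/
def codegrees (G : Type*) [Group G] : Set ℂ :=
  codegree '' irreducibleCharacters G

/-- The coclass `log_p |G| - c` of a finite `p`-group `G` of nilpotence class `c`. For a finite
`p`-group `Nat.log p |G|` is the exact logarithm; the difference is taken in `ℤ`. -/
def coclass (p : ℕ) (G : Type*) [Group G] : ℤ :=
  (Nat.log p (Nat.card G) : ℤ) - (Group.nilpotencyClass G : ℤ)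

end

/-! Write γᵢ for the lower central series and G' = γ₂. Codegrees of a quotient are codegrees of G,
so it suffices to find p² in some quotient. There are two sources. If G/G' does not have exponent p,
it has a linear character of order p² (`sq_mem_codegrees_of_pow_notMem_commutator`). If a quotient
has central derived subgroup of order p, and centre of exponent p and index at most p², then a
linear character of the centre that is nontrivial on the derived subgroup is fully ramified: the
character above it vanishes off the centre, has degree p, and has codegree p · p
(`sq_mem_codegrees_of_card_commutator_eq`).

Suppose G/G' has exponent p. The hypotheses give class at least 3, and coclass at most 3 gives |G :
γ₃| ≤ p⁵. Factoring out a subgroup of index p in γ₃ that contains γ₄ reduces to class 3 with |γ₃| =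
p. Let K = G' ∩ Z(G). If |G' : K| = p, then G/K is a quotient of the second kind.

Otherwise Q = G/γ₃ has |Q'| > p, and the bound p⁵ yields an abelian D ≥ Q' of index p in Q
(`IsPGroup.exists_abelian_index_dvd`). If some d in D \ Q' has order p, then Q/N is of the second
kind for any N of index p in Q' containing [Q, d]. If there is no such d, counting shows that the
p-th powers of D fill Q'. In the preimage of D commutators are central of order dividing p, so [dᵖ,
e] = [d, e]ᵖ = 1 and this preimage centralizes G'. Commutation with an element outside it then
embeds G'/K in γ₃, so |G' : K| = p after all. -/

open scoped commutatorElement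

/-! ### Irreducible characters over a linear character of a normal subgroup -/

/-- A finite-dimensional representation is equivalent to one on a coordinate space. -/
theorem exists_coordinate_representation {G V : Type*} [Group G] [AddCommGroup V] [Module ℂ V]
    [FiniteDimensional ℂ V] (σ : Representation ℂ G V) :
    ∃ ρ : Representation ℂ G (Fin (Module.finrank ℂ V) → ℂ),
      ∀ (g : G) (c : ℂ), σ g = c • LinearMap.id → ρ g = c • LinearMap.id := by
  let e := (Module.finBasis ℂ V).equivFun
  refine ⟨(e.conjRingEquiv.toMonoidHom).comp σ, fun g c h => ?_⟩
  ext v i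
  simp [h, LinearEquiv.conjRingEquiv]

/-- A nonzero representation in which the elements of `Z` act by scalars yields an irreducible one
with the same scalars. -/
theorem exists_irreducible_of_scalar {G V : Type*} [Group G] [AddCommGroup V] [Module ℂ V]
    [FiniteDimensional ℂ V] [Nontrivial V] (σ : Representation ℂ G V) (Z : Set G) (l : G → ℂ)
    (hσ : ∀ z ∈ Z, σ z = l z • LinearMap.id) :
    ∃ (n : ℕ) (ρ : Representation ℂ G (Fin n → ℂ)), ρ.IsIrreducible ∧
      ∀ z ∈ Z, ρ z = l z • LinearMap.id := by
  classical
  -- Take the least positive dimension in which `Z` acts by these scalars. A nonzero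
  -- subrepresentation inherits the scalars, so by minimality it is everything.
  have hex : ∃ n : ℕ, 0 < n ∧ ∃ ρ : Representation ℂ G (Fin n → ℂ),
      ∀ z ∈ Z, ρ z = l z • LinearMap.id := by
    obtain ⟨ρ, hρ⟩ := exists_coordinate_representation σ
    exact ⟨_, Module.finrank_pos, ρ, fun z hz => hρ z _ (hσ z hz)⟩
  obtain ⟨hn, ρ, hρ⟩ := Nat.find_spec hex
  have hmin := fun m => Nat.find_min' hex (m := m)
  generalize Nat.find hex = n at hn ρ hρ hmin
  refine ⟨n, ρ, ?_, hρ⟩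
  have : Nonempty (Fin n) := ⟨⟨0, hn⟩⟩
  have : Nontrivial (Subrepresentation ρ) := by
    refine ⟨⊥, ⊤, fun h => ?_⟩
    have := congrArg Subrepresentation.toSubmodule h
    exact bot_ne_top (α := Submodule ℂ (Fin n → ℂ)) this
  refine ⟨fun S => ?_⟩
  by_cases hS : S.toSubmodule = ⊥
  · exact Or.inl (Subrepresentation.toSubmodule_injective hS)
  · right
    obtain ⟨τ, hτ⟩ := exists_coordinate_representation S.toRepresentation
    have hpos : 0 < Module.finrank ℂ S.toSubmodule := by
      rw [pos_iff_ne_zero, ne_eq, Submodule.finrank_eq_zero]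
      exact hS
    have := hmin _ ⟨hpos, τ, fun z hz => hτ z _ (by
      ext v i
      simp [Subrepresentation.toRepresentation, hρ z hz])⟩
    apply Subrepresentation.toSubmodule_injective
    apply Submodule.eq_top_of_finrank_eq
    apply le_antisymm (Submodule.finrank_le _)
    simpa using this

/-- A conjugation-invariant linear character of a normal subgroup lies under an irreducible
representation on which the subgroup acts by scalars. -/
theorem exists_irreducible_extending {G : Type*} [Group G] [Finite G] (Z : Subgroup G)
    [hZ : Z.Normal] (l : Z →* ℂˣ) (hl : ∀ z w : Z, IsConj (z : G) w → l z = l w) :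
    ∃ (n : ℕ) (ρ : Representation ℂ G (Fin n → ℂ)), ρ.IsIrreducible ∧
      ∀ z : Z, ρ z = (l z : ℂ) • LinearMap.id := by
  classical
  -- This is the representation induced from `l`, acting by left translation. Invariance of `l`
  -- under conjugation is what makes `Z` act by scalars.
  let W : Submodule ℂ (G → ℂ) :=
    { carrier := {f | ∀ (x : G) (z : Z), (l z : ℂ) * f (x * z) = f x}
      add_mem' := fun {a b} ha hb x z => by simp [mul_add, ha x z, hb x z]
      zero_mem' := fun x z => by simp
      smul_mem' := fun c f hf x z => by
        simp only [Pi.smul_apply, smul_eq_mul]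
        rw [← hf x z]; ring }
  let σ : Representation ℂ G W :=
    { toFun := fun g =>
        { toFun := fun f => ⟨fun x => f.1 (g⁻¹ * x), fun x z => by
            simpa [mul_assoc] using f.2 (g⁻¹ * x) z⟩
          map_add' := fun f f' => rfl
          map_smul' := fun c f => rfl }
      map_one' := by ext f x; simp
      map_mul' := fun g h => by ext f x; simp [mul_assoc] }
  have hW : Nontrivial W := by
    refine ⟨⟨⟨fun x => if h : x ∈ Z then ((l ⟨x, h⟩)⁻¹ : ℂˣ) else 0, fun x z => ?_⟩, 0,
      fun h => ?_⟩⟩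
    · by_cases hx : x ∈ Z
      · have hxz : x * (z : G) ∈ Z := Z.mul_mem hx z.2
        have : (⟨x * z, hxz⟩ : Z) = ⟨x, hx⟩ * z := rfl
        simp only
        rw [dif_pos hx, dif_pos hxz, this, map_mul]
        simp
      · have hxz : x * (z : G) ∉ Z := fun h => hx ((Z.mul_mem_cancel_right z.2).1 h)
        simp [hx, hxz]
    · have := congrFun (congrArg Subtype.val h) 1
      simp [Z.one_mem] at this
  have key := exists_irreducible_of_scalar σ (Z : Set G)
    (fun g => if h : g ∈ Z then (l ⟨g, h⟩ : ℂ) else 0) (fun z hz => by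
      ext f x
      have hz' : z ∈ Z := hz
      have hc : x⁻¹ * z⁻¹ * x ∈ Z := by simpa using hZ.conj_mem z⁻¹ (Z.inv_mem hz') x⁻¹
      have h1 := f.2 x ⟨_, hc⟩
      have h2 : l ⟨_, hc⟩ = l ⟨z, hz'⟩⁻¹ :=
        hl _ _ (isConj_iff.2 ⟨x, by simp [mul_assoc]⟩)
      rw [h2] at h1
      simp only [map_inv, mul_assoc, mul_inv_cancel_left] at h1
      have h3 : f.1 (z⁻¹ * x) = (l ⟨z, hz'⟩ : ℂ) * f.1 x := by
        rw [← h1]; simp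
      simpa [σ, hz'] using h3)
  obtain ⟨n, ρ, h1, h2⟩ := key
  exact ⟨n, ρ, h1, fun z => by simpa using h2 z z.2⟩

/-- A conjugation-invariant linear character of a normal subgroup `Z` which is nontrivial on
`[g, G] ∩ Z` for every `g ∉ Z` is fully ramified. -/
theorem exists_fully_ramified_character {G : Type*} [Group G] [Finite G] (Z : Subgroup G)
    [hZ : Z.Normal] (l : Z →* ℂˣ) (hl : ∀ z w : Z, IsConj (z : G) w → l z = l w)
    (hram : ∀ g ∉ Z, ∃ (h : G) (hz : ⁅h, g⁆ ∈ Z), l ⟨⁅h, g⁆, hz⟩ ≠ 1) :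
    ∃ χ ∈ irreducibleCharacters G, ∃ n : ℕ, χ 1 = n ∧ n ^ 2 = Z.index ∧
      characterKernel χ = ((l.ker).map Z.subtype : Subgroup G) := by
  classical
  obtain ⟨n, ρ, hρ, hs⟩ := exists_irreducible_extending Z l hl
  have h1 : ρ.character 1 = n := by simp
  have hin : ∀ z : Z, ρ.character z = (l z : ℂ) * n := fun z => by
    simp [Representation.character, hs z]
  have hout : ∀ g ∉ Z, ρ.character g = 0 := fun g hg => by
    obtain ⟨h, hz, hne⟩ := hram g hg
    -- Conjugating g by h multiplies it by [h, g], which acts by a scalar different from 1; so the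
    -- character vanishes at g.
    have h2 : ρ.character (h * g * h⁻¹) = (l ⟨_, hz⟩ : ℂ) * ρ.character g := by
      have : h * g * h⁻¹ = ⁅h, g⁆ * g := by simp [commutatorElement_def]
      rw [this, Representation.character, map_mul, hs ⟨_, hz⟩]
      simp [Representation.character, Module.End.mul_eq_comp]
    rw [Representation.char_conj] at h2
    by_contra h0
    apply hne
    ext
    exact mul_right_cancel₀ h0 (by rw [← h2]; simp)
  have hn0 : n ≠ 0 := by
    rintro rfl
    have : Nontrivial (Subrepresentation ρ) := hρ.toNontrivial
    obtain ⟨a, b, hab⟩ := this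
    exact hab (Subrepresentation.toSubmodule_injective (Subsingleton.elim _ _))
  have hnC : (n : ℂ) ≠ 0 := by exact_mod_cast hn0
  refine ⟨ρ.character, ⟨n, ρ, hρ, rfl⟩, n, h1, ?_, ?_⟩
  · have := Fintype.ofFinite G
    have : Invertible (Nat.card G : ℂ) := invertibleOfNonzero (by simp)
    -- As the character vanishes off `Z`, its norm being 1 reads |Z| n² = |G|.
    have ho := Representation.char_orthonormal ρ ρ
    rw [if_pos ⟨Representation.Equiv.refl ρ⟩] at ho
    have hsum : ∑ g : G, ρ.character g * ρ.character g⁻¹ = (Nat.card Z : ℂ) * (n : ℂ) ^ 2 := by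
      have : ∀ g : G, ρ.character g * ρ.character g⁻¹ = if g ∈ Z then (n : ℂ) ^ 2 else 0 := by
        intro g
        split_ifs with hg
        · have a := hin ⟨g, hg⟩
          have b := hin ⟨g, hg⟩⁻¹
          simp only [Subgroup.coe_inv, map_inv, Units.val_inv_eq_inv_val] at a b
          rw [a, b]
          field_simp
        · rw [hout g hg, zero_mul]
      simp_rw [this]
      rw [← Finset.sum_filter, Finset.sum_const, nsmul_eq_mul, Nat.card_eq_fintype_card,
        Fintype.card_subtype]
    rw [hsum, ← Z.card_mul_index] at ho
    have hZ0 : (Nat.card Z : ℂ) ≠ 0 := by exact_mod_cast Nat.card_pos.ne'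
    have hI0 : (Z.index : ℂ) ≠ 0 := by exact_mod_cast Z.index_ne_zero_of_finite
    push_cast at ho
    field_simp at ho
    exact_mod_cast ho
  · ext g
    simp only [characterKernel, Set.mem_ofPred_eq, h1, SetLike.mem_coe, Subgroup.mem_map,
      MonoidHom.mem_ker, Subgroup.coe_subtype]
    constructor
    · intro hg
      by_cases hgZ : g ∈ Z
      · refine ⟨⟨g, hgZ⟩, ?_, rfl⟩
        have := hin ⟨g, hgZ⟩
        simp only [hg] at this
        ext
        exact mul_right_cancel₀ hnC (by rw [← this]; simp)
      · rw [hout g hgZ] at hg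
        exact absurd hg.symm hnC
    · rintro ⟨z, hz, rfl⟩
      rw [hin, hz]; simp

/-! ### Codegrees: inflation from quotients, and the two sources of p² -/

/-- The codegree of a fully ramified character. -/
theorem mul_card_range_mem_codegrees {G : Type*} [Group G] [Finite G] (Z : Subgroup G)
    [hZ : Z.Normal] (l : Z →* ℂˣ) (hl : ∀ z w : Z, IsConj (z : G) w → l z = l w)
    (hram : ∀ g ∉ Z, ∃ (h : G) (hz : ⁅h, g⁆ ∈ Z), l ⟨⁅h, g⁆, hz⟩ ≠ 1) :
    ∃ n : ℕ, n ^ 2 = Z.index ∧ ((n * Nat.card l.range : ℕ) : ℂ) ∈ codegrees G := by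
  obtain ⟨χ, hχ, n, h1, h2, h3⟩ := exists_fully_ramified_character Z l hl hram
  refine ⟨n, h2, χ, hχ, ?_⟩
  have hk : Nat.card (characterKernel χ) = Nat.card l.ker := by
    rw [h3]
    exact (Nat.card_congr (l.ker.equivMapOfInjective _ Z.subtype_injective).toEquiv).symm
  have hG : Nat.card G = Nat.card l.ker * Nat.card l.range * n ^ 2 := by
    rw [h2, ← Z.card_mul_index, ← l.ker.card_mul_index, Subgroup.index_ker]
  have hn : n ≠ 0 := by
    rintro rfl
    exact Z.index_ne_zero_of_finite (by rw [← h2]; rfl)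
  have hn' : (n : ℂ) ≠ 0 := by exact_mod_cast hn
  have hk0 : (Nat.card l.ker : ℂ) ≠ 0 := by exact_mod_cast Nat.card_pos.ne'
  rw [codegree, hk, h1, hG]
  push_cast
  field_simp

/-- Characters of a quotient inflate to the group with the same codegree. -/
theorem codegrees_quotient_subset {G : Type*} [Group G] [Finite G] (N : Subgroup G) [N.Normal] :
    codegrees (G ⧸ N) ⊆ codegrees G := by
  rintro _ ⟨_, ⟨n, ρ, hρ, rfl⟩, rfl⟩
  let τ : Representation ℂ G (Fin n → ℂ) := ρ.comp (QuotientGroup.mk' N)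
  have hτ : ∀ g, τ.character g = ρ.character (g : G ⧸ N) := fun g => rfl
  refine ⟨τ.character, ⟨n, τ, ?_, rfl⟩, ?_⟩
  · let e : Subrepresentation ρ ≃o Subrepresentation τ :=
      { toFun := fun S => ⟨S.toSubmodule, fun g => S.apply_mem_toSubmodule (g : G ⧸ N)⟩
        invFun := fun S => ⟨S.toSubmodule, fun g => by
          obtain ⟨g, rfl⟩ := QuotientGroup.mk_surjective g
          exact fun v hv => S.apply_mem_toSubmodule g hv⟩
        left_inv := fun S => rfl
        right_inv := fun S => rfl
        map_rel_iff' := Iff.rfl }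
    exact e.isSimpleOrder_iff.1 hρ
  · have hk : Nat.card (characterKernel τ.character) =
        Nat.card N * Nat.card (characterKernel ρ.character) := by
      have : characterKernel τ.character =
          ((↑) : G → G ⧸ N) ⁻¹' characterKernel ρ.character := by
        ext g
        simp [characterKernel, hτ]
      rw [this]
      exact QuotientGroup.card_preimage_mk N _
    rw [codegree, codegree, hk, hτ, ← N.card_mul_index, Subgroup.index]
    have : (Nat.card N : ℂ) ≠ 0 := by exact_mod_cast Nat.card_pos.ne'
    push_cast
    rw [mul_div_mul_left _ _ this]
    rfl

/-- A finite subgroup of ℂˣ is cyclic, so its order equals its exponent. -/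
theorem card_range_dvd_iff {A : Type*} [Group A] [Finite A] (f : A →* ℂˣ) (n : ℕ) :
    Nat.card f.range ∣ n ↔ ∀ a, f a ^ n = 1 := by
  have : Finite f.range := Finite.of_surjective _ f.rangeRestrict_surjective
  rw [← IsCyclic.exponent_eq_card, Monoid.exponent_dvd_iff_forall_pow_eq_one]
  constructor
  · intro h a
    exact congrArg Subtype.val (h ⟨f a, a, rfl⟩)
  · rintro h ⟨_, a, rfl⟩
    exact Subtype.ext (h a)

/-- A finite `p`-group whose abelianization is not of exponent `p` has a linear character of
codegree `p ^ 2`. -/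
theorem sq_mem_codegrees_of_pow_notMem_commutator {p : ℕ} [hp : Fact p.Prime] {G : Type*} [Group G]
    [Finite G] (hG : IsPGroup p G) {g : G} (hg : g ^ p ∉ commutator G) :
    (p : ℂ) ^ 2 ∈ codegrees G := by
  have hA : IsPGroup p (Abelianization G) :=
    hG.of_surjective Abelianization.of QuotientGroup.mk_surjective
  have : Finite (Abelianization G) := Finite.of_surjective _ QuotientGroup.mk_surjective
  obtain ⟨b, hb⟩ : ∃ b : Abelianization G, orderOf b = p ^ 2 := by
    obtain ⟨k, hk⟩ := IsPGroup.iff_orderOf.1 hA (Abelianization.of g)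
    have hk2 : 2 ≤ k := by
      by_contra h
      apply hg
      rw [← Abelianization.ker_of, MonoidHom.mem_ker, map_pow, ← orderOf_dvd_iff_pow_eq_one, hk]
      exact (pow_dvd_pow p (by omega : k ≤ 1)).trans (pow_one p).dvd
    refine ⟨Abelianization.of g ^ p ^ (k - 2), ?_⟩
    rw [orderOf_pow_of_dvd (pow_ne_zero _ hp.out.ne_zero) (hk ▸ pow_dvd_pow _ (by omega)), hk,
      Nat.pow_div (by omega) hp.out.pos]
    congr 1
    omega
  -- A finite abelian group is isomorphic to its dual, which therefore also has an element of order
  -- p².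
  obtain ⟨e⟩ := CommGroup.monoidHom_mulEquiv_of_hasEnoughRootsOfUnity (Abelianization G) ℂ
  let φ := e.symm b
  have hφ : orderOf φ = p ^ 2 := by rw [← hb]; exact e.symm.orderOf_eq b
  let l : (⊤ : Subgroup G) →* ℂˣ := (φ.comp Abelianization.of).comp (⊤ : Subgroup G).subtype
  have hlpow : ∀ m : ℕ, (∀ a, l a ^ m = 1) ↔ φ ^ m = 1 := by
    intro m
    constructor
    · intro h
      ext x
      exact congrArg Units.val (h ⟨x, trivial⟩)
    · intro h a
      exact DFunLike.congr_fun h (Abelianization.of (a : G))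
  have hcard : Nat.card l.range = p ^ 2 :=
    Nat.dvd_antisymm ((card_range_dvd_iff l _).2 ((hlpow _).2 (hφ ▸ pow_orderOf_eq_one φ)))
      (hφ ▸ orderOf_dvd_of_pow_eq_one ((hlpow _).1 ((card_range_dvd_iff l _).1 dvd_rfl)))
  obtain ⟨n, hn, h⟩ := mul_card_range_mem_codegrees (⊤ : Subgroup G) l (fun z w h => by
    obtain ⟨c, hc⟩ := isConj_iff.1 h
    have hz : w = ⟨c, trivial⟩ * z * ⟨c, trivial⟩⁻¹ := Subtype.ext hc.symm
    rw [hz, map_mul, map_mul, map_inv, mul_comm, inv_mul_cancel_left])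
    (fun g hg => absurd trivial hg)
  have hn1 : n = 1 := by simpa using hn
  rw [hn1, hcard] at h
  simpa using h

open scoped IsMulCommutative in
/-- A `p`-group with commutator subgroup of order `p` and center of exponent `p` and index at most
`p ^ 2` has a character of codegree `p ^ 2`. -/
theorem sq_mem_codegrees_of_card_commutator_eq {p : ℕ} [hp : Fact p.Prime] {G : Type*} [Group G]
    [Finite G] (hG : IsPGroup p G) (hcard : Nat.card (commutator G) = p)
    (hcen : commutator G ≤ Subgroup.center G) (hexp : ∀ z ∈ Subgroup.center G, z ^ p = 1)
    (hidx : (Subgroup.center G).index ≤ p ^ 2) : (p : ℂ) ^ 2 ∈ codegrees G := by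
  have hne : commutator G ≠ ⊥ := by
    intro h
    rw [h, Subgroup.card_bot] at hcard
    exact hp.out.one_lt.ne hcard
  obtain ⟨a, haG, ha1⟩ := (Subgroup.bot_or_exists_ne_one (commutator G)).resolve_left hne
  let a' : Subgroup.center G := ⟨a, hcen haG⟩
  obtain ⟨l, hl⟩ := CommGroup.exists_apply_ne_one_of_hasEnoughRootsOfUnity
    (Subgroup.center G) ℂ (a := a') (fun h => ha1 (congrArg Subtype.val h))
  obtain ⟨n, hn, h⟩ := mul_card_range_mem_codegrees (Subgroup.center G) l (fun z w h => by
    obtain ⟨c, hc⟩ := isConj_iff.1 h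
    have : z = w := by
      apply Subtype.ext
      rw [← hc, Subgroup.mem_center_iff.1 z.2 c, mul_inv_cancel_right]
    rw [this]) (fun g hg => by
      obtain ⟨h, hh⟩ : ∃ h : G, ⁅h, g⁆ ≠ 1 := by
        by_contra! hcon
        exact hg (Subgroup.mem_center_iff.2 fun h =>
          commutatorElement_eq_one_iff_mul_comm.1 (hcon h))
      have hm : ⁅h, g⁆ ∈ commutator G :=
        Subgroup.commutator_mem_commutator (Subgroup.mem_top _) (Subgroup.mem_top _)
      refine ⟨h, hcen hm, fun hl1 => hl ?_⟩
      -- The derived subgroup has prime order, so any nontrivial commutator generates it; `l` cannot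
      -- be trivial there without being trivial on a.
      have hz : a ∈ Subgroup.zpowers (⁅h, g⁆ : G) := by
        have := mem_zpowers_of_prime_card (G := commutator G) (p := p) hcard (g := ⟨_, hm⟩)
          (g' := ⟨a, haG⟩) (fun h => hh (congrArg Subtype.val h))
        obtain ⟨k, hk⟩ := Subgroup.mem_zpowers_iff.1 this
        exact Subgroup.mem_zpowers_iff.2 ⟨k, congrArg Subtype.val hk⟩
      obtain ⟨k, hk⟩ := Subgroup.mem_zpowers_iff.1 hz
      have : a' = (⟨⁅h, g⁆, hcen hm⟩ : Subgroup.center G) ^ k := Subtype.ext hk.symm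
      rw [this, map_zpow, hl1, one_zpow])
  have hr : Nat.card l.range = p := by
    have hd : Nat.card l.range ∣ p := (card_range_dvd_iff l p).2 fun z => by
      rw [← map_pow]
      have : z ^ p = 1 := Subtype.ext (hexp z z.2)
      rw [this, map_one]
    refine ((Nat.dvd_prime hp.out).1 hd).resolve_left fun h1 => hl ?_
    have := (card_range_dvd_iff l 1).1 (by rw [h1]) a'
    simpa using this
  -- The index n² is 1, p or p²: the first would make the group abelian, and p is not a square.
  have hnp : n = p := by
    obtain ⟨k, hk⟩ := hG.index (Subgroup.center G)
    have hk2 : k ≤ 2 := (Nat.pow_le_pow_iff_right hp.out.one_lt).1 (hk ▸ hidx)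
    rw [hk] at hn
    interval_cases k
    · exact absurd ((commutator_eq_bot_iff_center_eq_top G).2
        (Subgroup.index_eq_one.1 (by simpa using hk))) hne
    · exact absurd (hn ▸ (pow_one p).symm ▸ hp.out) (Nat.Prime.not_prime_pow le_rfl)
    · exact Nat.pow_left_injective (two_ne_zero) hn
  rw [hr, hnp] at h
  rw [sq]
  exact_mod_cast h

/-! ### Commutator calculus, mostly in class two -/

section Commutators

variable {G : Type*} [Group G]

theorem commutatorElement_mem_commutator (x y : G) : ⁅x, y⁆ ∈ commutator G :=
  Subgroup.commutator_mem_commutator (Subgroup.mem_top _) (Subgroup.mem_top _)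

theorem commutatorElement_mul_left_of_commute {a b c : G} (h : Commute a ⁅b, c⁆) :
    ⁅a * b, c⁆ = ⁅b, c⁆ * ⁅a, c⁆ := by
  rw [commutatorElement_mul_left_eq_conj_mul, h.eq, mul_inv_cancel_right]

theorem commutatorElement_mul_right_of_commute {a b c : G} (h : Commute b ⁅a, c⁆) :
    ⁅a, b * c⁆ = ⁅a, b⁆ * ⁅a, c⁆ := by
  rw [← commutatorElement_inv, commutatorElement_mul_left_of_commute
    (by rw [← commutatorElement_inv]; exact h.inv_right), mul_inv_rev, commutatorElement_inv,
    commutatorElement_inv]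

theorem commutatorElement_pow_left {z g : G} (h : Commute z ⁅z, g⁆) (n : ℕ) :
    ⁅z ^ n, g⁆ = ⁅z, g⁆ ^ n := by
  induction n with
  | zero => simp
  | succ n ih =>
    rw [pow_succ', commutatorElement_mul_left_of_commute (by rw [ih]; exact h.pow_right n), ih,
      pow_succ]

theorem commutatorElement_pow_right {z g : G} (h : Commute g ⁅z, g⁆) (n : ℕ) :
    ⁅z, g ^ n⁆ = ⁅z, g⁆ ^ n := by
  rw [← commutatorElement_inv, commutatorElement_pow_left
    (by rw [← commutatorElement_inv]; exact h.inv_right), ← commutatorElement_inv z g, inv_pow,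
    inv_inv]

theorem commutatorElement_zpow_right {z g : G} (h : Commute g ⁅z, g⁆) (n : ℤ) :
    ⁅z, g ^ n⁆ = ⁅z, g⁆ ^ n := by
  cases n with
  | ofNat n => simpa using commutatorElement_pow_right h n
  | negSucc n =>
    rw [zpow_negSucc, zpow_negSucc, ← commutatorElement_pow_right h,
      commutatorElement_inv_right, ← commutatorElement_inv z]
    have hc : Commute (g ^ (n + 1)) ⁅z, g ^ (n + 1)⁆ := by
      rw [commutatorElement_pow_right h]
      exact h.pow_pow _ _
    rw [mul_assoc, ← hc.inv_right.eq, inv_mul_cancel_left]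

/-- The number of conjugates of `g` is bounded by the order of a subgroup containing all
commutators with `g`. -/
theorem index_centralizer_singleton_le (g : G) (S : Subgroup G) [Finite S]
    (hS : ∀ h : G, ⁅h, g⁆ ∈ S) : (Subgroup.centralizer {g}).index ≤ Nat.card S := by
  refine Nat.card_le_card_of_injective
    (fun q : G ⧸ Subgroup.centralizer {g} => (⟨⁅q.out, g⁆, hS _⟩ : S)) fun q r hqr => ?_
  have h : ⁅q.out, g⁆ = ⁅r.out, g⁆ := congrArg Subtype.val hqr
  rw [commutatorElement_def, commutatorElement_def, mul_left_inj] at h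
  rw [← q.out_eq', ← r.out_eq', QuotientGroup.eq, Subgroup.mem_centralizer_singleton_iff]
  have h2 := congrArg (fun t => (Quotient.out q)⁻¹ * t * Quotient.out r) h
  simp only [mul_assoc, inv_mul_cancel_left, inv_mul_cancel, mul_one] at h2
  simp only [mul_assoc]
  exact h2.symm

theorem eq_top_of_index_prime {D T : Subgroup G} (hD : D.index.Prime) (hDT : D ≤ T) {g : G}
    (hgT : g ∈ T) (hgD : g ∉ D) : T = ⊤ := by
  have h := Subgroup.relIndex_mul_index hDT
  rcases (Nat.dvd_prime hD).1 (Subgroup.index_dvd_of_le hDT) with h1 | h1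
  · exact Subgroup.index_eq_one.1 h1
  · rw [h1] at h
    have h2 : D.relIndex T = 1 := Nat.eq_of_mul_eq_mul_right hD.pos (by rw [h, one_mul])
    exact absurd (Subgroup.relIndex_eq_one.1 h2 hgT) hgD

/-- A group with an abelian subgroup of prime index `p` and commutator subgroup of order at most
`p` has a center of index at most `p ^ 2`. -/
theorem index_center_le_sq [Finite G] {p : ℕ} (hp : p.Prime) {A : Subgroup G}
    (hA : ∀ x ∈ A, ∀ y ∈ A, x * y = y * x) (hidx : A.index ∣ p)
    (hcard : Nat.card (commutator G) ≤ p) : (Subgroup.center G).index ≤ p ^ 2 := by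
  rcases (Nat.dvd_prime hp).1 hidx with h1 | h1
  · rw [Subgroup.index_eq_one] at h1
    have : Subgroup.center G = ⊤ := by
      refine (Subgroup.eq_top_iff' _).2 fun x => Subgroup.mem_center_iff.2 fun y => ?_
      exact hA y (h1 ▸ Subgroup.mem_top y) x (h1 ▸ Subgroup.mem_top x)
    rw [this, Subgroup.index_top]
    exact Nat.one_le_pow _ _ hp.pos
  · obtain ⟨g, hg⟩ : ∃ g, g ∉ A := by
      by_contra! h
      rw [(Subgroup.eq_top_iff' A).2 h, Subgroup.index_top] at h1
      exact hp.one_lt.ne h1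
    -- An element of A commuting with g is centralized by A and by g, which together generate the
    -- group.
    have hle : A ⊓ Subgroup.centralizer {g} ≤ Subgroup.center G := by
      rintro x ⟨hxA, hxg⟩
      have hT : Subgroup.centralizer {x} = ⊤ := by
        refine eq_top_of_index_prime (D := A) (h1 ▸ hp) (fun y hy => ?_) (g := g) ?_ hg
        · exact Subgroup.mem_centralizer_singleton_iff.2 (hA _ hy _ hxA)
        · exact Subgroup.mem_centralizer_singleton_iff.2
            (Subgroup.mem_centralizer_singleton_iff.1 hxg).symm
      refine Subgroup.mem_center_iff.2 fun y => ?_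
      exact Subgroup.mem_centralizer_singleton_iff.1 (hT ▸ Subgroup.mem_top y)
    have h2 : (Subgroup.centralizer {g}).index ≤ p :=
      (index_centralizer_singleton_le g _ fun h => commutatorElement_mem_commutator h g).trans hcard
    calc (Subgroup.center G).index ≤ (A ⊓ Subgroup.centralizer {g}).index :=
          Nat.le_of_dvd (Nat.pos_of_ne_zero Subgroup.index_ne_zero_of_finite)
            (Subgroup.index_dvd_of_le hle)
      _ ≤ A.index * (Subgroup.centralizer {g}).index := Subgroup.index_inf_le
      _ ≤ p * p := Nat.mul_le_mul h1.le h2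
      _ = p ^ 2 := (sq p).symm

/-- In a group of class two with an abelian subgroup `D` of prime index containing the commutator
subgroup, the order of the commutator subgroup is at most its index in `D`. -/
theorem card_commutator_mul_self_le [Finite G] (hcl : commutator G ≤ Subgroup.center G)
    {D : Subgroup G} (hGD : commutator G ≤ D) (hD : ∀ x ∈ D, ∀ y ∈ D, x * y = y * x)
    (hidx : D.index.Prime) : Nat.card (commutator G) * Nat.card (commutator G) ≤ Nat.card D := by
  obtain ⟨g, hg⟩ : ∃ g, g ∉ D := by
    by_contra! h
    rw [(Subgroup.eq_top_iff' D).2 h, Subgroup.index_top] at hidx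
    exact Nat.not_prime_one hidx
  have hcc : ∀ a x y : G, Commute a ⁅x, y⁆ := fun a x y =>
    Subgroup.mem_center_iff.1 (hcl (commutatorElement_mem_commutator x y)) a
  let ψ : D →* G :=
    { toFun := fun d => ⁅(d : G), g⁆
      map_one' := by simp
      map_mul' := fun a b => by
        rw [Subgroup.coe_mul, commutatorElement_mul_left_of_commute (hcc _ _ _)]
        exact hcc _ _ _ }
  have hψc : ψ.range ≤ Subgroup.center G := by
    rintro _ ⟨d, rfl⟩
    exact hcl (commutatorElement_mem_commutator _ _)
  have hN : ψ.range.Normal := by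
    refine ⟨fun x hx y => ?_⟩
    rw [Subgroup.mem_center_iff.1 (hψc hx) y, mul_inv_cancel_right]
    exact hx
  -- T x consists of the y with [y, x] in [D, g]. Each T x turns out to contain D and g, first for x
  -- = g, then for x in D, then for all x; hence G' = [D, g].
  let T : G → Subgroup G := fun x =>
    (Subgroup.centralizer {(x : G ⧸ ψ.range)}).comap (QuotientGroup.mk' ψ.range)
  have hT : ∀ x y, y ∈ T x ↔ ⁅y, x⁆ ∈ ψ.range := by
    intro x y
    rw [Subgroup.mem_comap, Subgroup.mem_centralizer_singleton_iff,
      ← commutatorElement_eq_one_iff_mul_comm, QuotientGroup.mk'_apply,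
      ← QuotientGroup.eq_one_iff]
    rfl
  have hg' : T g = ⊤ := eq_top_of_index_prime hidx
    (fun d hd => (hT _ _).2 ⟨⟨d, hd⟩, rfl⟩) ((hT _ _).2 (by simp)) hg
  have hsymm : ∀ x y, y ∈ T x → x ∈ T y := fun x y h => by
    rw [hT, ← commutatorElement_inv]
    exact Subgroup.inv_mem _ ((hT _ _).1 h)
  have hd' : ∀ d ∈ D, T d = ⊤ := fun d hd => eq_top_of_index_prime hidx
    (fun e he => (hT _ _).2 (by
      rw [commutatorElement_eq_one_iff_mul_comm.2 (hD e he d hd)]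
      exact Subgroup.one_mem _))
    (hsymm _ _ (hg' ▸ Subgroup.mem_top d)) hg
  have hall : ∀ x, T x = ⊤ := fun x => eq_top_of_index_prime hidx
    (fun d hd => hsymm _ _ (hd' d hd ▸ Subgroup.mem_top x))
    (hsymm _ _ (hg' ▸ Subgroup.mem_top x)) hg
  have hle : commutator G ≤ ψ.range :=
    Subgroup.commutator_le.2 fun y _ x _ => (hT x y).1 (hall x ▸ Subgroup.mem_top y)
  have hker : (commutator G).subgroupOf D ≤ ψ.ker := fun d hd =>
    commutatorElement_eq_one_iff_mul_comm.2 (Subgroup.mem_center_iff.1 (hcl hd) g).symm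
  calc Nat.card (commutator G) * Nat.card (commutator G)
      ≤ Nat.card ψ.ker * Nat.card ψ.range := by
        refine Nat.mul_le_mul ?_ (Subgroup.card_le_of_le hle)
        rw [← Nat.card_congr (Subgroup.subgroupOfEquivOfLe hGD).toEquiv]
        exact Subgroup.card_le_of_le hker
    _ = Nat.card D := by rw [← ψ.ker.card_mul_index, Subgroup.index_ker]

theorem index_dvd_of_sup_zpowers_eq_top {p : ℕ} {D : Subgroup G} [D.Normal] {g : G}
    (h : D ⊔ Subgroup.zpowers g = ⊤) (hg : g ^ p ∈ D) : D.index ∣ p := by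
  have hz : ∀ q : G ⧸ D, q ∈ Subgroup.zpowers (g : G ⧸ D) := by
    have : (D ⊔ Subgroup.zpowers g).map (QuotientGroup.mk' D) = ⊤ := by
      rw [h, ← MonoidHom.range_eq_map, MonoidHom.range_eq_top]
      exact QuotientGroup.mk'_surjective D
    rw [Subgroup.map_sup, QuotientGroup.map_mk'_self, bot_sup_eq, MonoidHom.map_zpowers] at this
    intro q
    have hq : q ∈ (⊤ : Subgroup (G ⧸ D)) := Subgroup.mem_top q
    rwa [← this] at hq
  rw [Subgroup.index, ← orderOf_eq_card_of_forall_mem_zpowers hz, orderOf_dvd_iff_pow_eq_one,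
    ← QuotientGroup.mk_pow, QuotientGroup.eq_one_iff]
  exact hg

theorem commutator_sup_zpowers_comm (hcl : commutator G ≤ Subgroup.center G) {x y : G}
    (hxy : ⁅x, y⁆ = 1) {a b : G}
    (ha : a ∈ commutator G ⊔ Subgroup.zpowers x ⊔ Subgroup.zpowers y)
    (hb : b ∈ commutator G ⊔ Subgroup.zpowers x ⊔ Subgroup.zpowers y) : a * b = b * a := by
  rw [commutatorElement_eq_one_iff_mul_comm] at hxy
  have hT : ∀ S : Set G, x ∈ Subgroup.centralizer S → y ∈ Subgroup.centralizer S →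
      commutator G ⊔ Subgroup.zpowers x ⊔ Subgroup.zpowers y ≤ Subgroup.centralizer S := by
    intro S hx hy
    refine sup_le (sup_le (hcl.trans (Subgroup.center_le_centralizer S)) ?_) ?_
    · rwa [Subgroup.zpowers_le]
    · rwa [Subgroup.zpowers_le]
  have hsingle : ∀ u v : G, u ∈ Subgroup.centralizer {v} ↔ u * v = v * u := fun u v =>
    Subgroup.mem_centralizer_singleton_iff
  have h1 := (hsingle b x).1 (hT {x} ((hsingle _ _).2 rfl) ((hsingle _ _).2 hxy.symm) hb)
  have h2 := (hsingle b y).1 (hT {y} ((hsingle _ _).2 hxy) ((hsingle _ _).2 rfl) hb)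
  exact (hsingle a b).1 (hT {b} ((hsingle _ _).2 h1.symm) ((hsingle _ _).2 h2.symm) ha)

/-- If [x, y] = [x, g]ⁱ [y, g]ʲ, bilinearity makes x gʲ and y g⁻ⁱ commute. Together with G' they
generate D, and g generates the quotient by D, where its p-th power is trivial. -/
theorem exists_abelian_of_commutatorElement_eq {p : ℕ} (hcl : commutator G ≤ Subgroup.center G)
    (hexp : ∀ x : G, x ^ p ∈ commutator G) {x y g : G}
    (htop : commutator G ⊔ Subgroup.zpowers x ⊔ Subgroup.zpowers y ⊔ Subgroup.zpowers g = ⊤)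
    (hrel : ⁅x, y⁆ ∈ Subgroup.closure {⁅x, g⁆, ⁅y, g⁆}) :
    ∃ D : Subgroup G, commutator G ≤ D ∧ (∀ x ∈ D, ∀ y ∈ D, x * y = y * x) ∧ D.index ∣ p := by
  have hcc : ∀ a x y : G, Commute a ⁅x, y⁆ := fun a x y =>
    Subgroup.mem_center_iff.1 (hcl (commutatorElement_mem_commutator x y)) a
  obtain ⟨i, j, hij⟩ : ∃ i j : ℤ, ⁅x, y⁆ = ⁅x, g⁆ ^ i * ⁅y, g⁆ ^ j := by
    refine Subgroup.closure_induction (fun c hc => ?_) ⟨0, 0, by simp⟩ ?_ ?_ hrel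
    · rcases hc with rfl | rfl
      · exact ⟨1, 0, by simp⟩
      · exact ⟨0, 1, by simp⟩
    · rintro _ _ - - ⟨i, j, rfl⟩ ⟨k, l, rfl⟩
      refine ⟨i + k, j + l, ?_⟩
      rw [zpow_add, zpow_add, mul_assoc, mul_assoc, ← mul_assoc (⁅y, g⁆ ^ j),
        (((hcc ⁅y, g⁆ x g).zpow_zpow j k)).eq, mul_assoc]
    · rintro _ - ⟨i, j, rfl⟩
      refine ⟨-i, -j, ?_⟩
      rw [zpow_neg, zpow_neg, mul_inv_rev]
      exact ((hcc ⁅y, g⁆ x g).zpow_zpow j i).inv_inv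
  have hxy : ⁅x * g ^ j, y * g ^ (-i)⁆ = 1 := by
    rw [commutatorElement_mul_left_of_commute (hcc _ _ _),
      commutatorElement_mul_right_of_commute (hcc _ _ _),
      commutatorElement_mul_right_of_commute (hcc _ _ _),
      commutatorElement_zpow_right (z := x) (hcc _ _ _), hij]
    have h1 : ⁅g ^ j, g ^ (-i)⁆ = 1 :=
      commutatorElement_eq_one_iff_commute.2 ((Commute.refl g).zpow_zpow _ _)
    have h2 : ⁅g ^ j, y⁆ = (⁅y, g⁆ ^ j)⁻¹ := by
      rw [← commutatorElement_inv, commutatorElement_zpow_right (hcc _ _ _)]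
    rw [h1, h2, ((hcc ⁅y, g⁆ x g).zpow_zpow j i).symm.eq, zpow_neg]
    simp
  refine ⟨_, le_sup_left.trans le_sup_left,
    fun a ha b hb => commutator_sup_zpowers_comm hcl hxy ha hb, ?_⟩
  set D := commutator G ⊔ Subgroup.zpowers (x * g ^ j) ⊔ Subgroup.zpowers (y * g ^ (-i)) with hD
  have hGD : commutator G ≤ D := le_sup_left.trans le_sup_left
  have : D.Normal := Subgroup.Normal.of_commutator_le _ hGD
  refine index_dvd_of_sup_zpowers_eq_top (g := g) ?_ (hGD (hexp g))
  have hg : g ∈ D ⊔ Subgroup.zpowers g := Subgroup.mem_sup_right (Subgroup.mem_zpowers g)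
  rw [eq_top_iff, ← htop]
  refine sup_le (sup_le (sup_le (hGD.trans le_sup_left) ?_) ?_) le_sup_right
  · rw [Subgroup.zpowers_le, ← Subgroup.mul_mem_cancel_right _ (Subgroup.zpow_mem _ hg j)]
    exact Subgroup.mem_sup_left (Subgroup.mem_sup_left
      (Subgroup.mem_sup_right (Subgroup.mem_zpowers _)))
  · rw [Subgroup.zpowers_le, ← Subgroup.mul_mem_cancel_right _ (Subgroup.zpow_mem _ hg (-i))]
    exact Subgroup.mem_sup_left (Subgroup.mem_sup_right (Subgroup.mem_zpowers _))

end Commutators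

/-! ### Generators and abelian subgroups of index p in p-groups -/

section PGroup

variable {p : ℕ} [hp : Fact p.Prime] {G : Type*} [Group G] [Finite G]

theorem IsPGroup.card_mul_le_of_lt (hG : IsPGroup p G) {H K : Subgroup G} (h : H < K) :
    Nat.card H * p ≤ Nat.card K := by
  obtain ⟨a, ha⟩ := IsPGroup.iff_card.1 (hG.to_subgroup H)
  obtain ⟨b, hb⟩ := IsPGroup.iff_card.1 (hG.to_subgroup K)
  have hlt : Nat.card H < Nat.card K := by
    refine lt_of_le_of_ne (Subgroup.card_le_of_le h.le) fun he => h.ne ?_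
    exact Subgroup.eq_of_le_of_card_ge h.le he.ge
  rw [ha, hb] at hlt ⊢
  rw [← pow_succ]
  exact Nat.pow_le_pow_right hp.out.pos ((Nat.pow_lt_pow_iff_right hp.out.one_lt).1 hlt)

theorem IsPGroup.exists_index_sup_zpowers_le (hG : IsPGroup p G) (S : Subgroup G) {k : ℕ}
    (hS : S.index ≤ p ^ (k + 1)) : ∃ x, (S ⊔ Subgroup.zpowers x).index ≤ p ^ k := by
  by_cases hT : S = ⊤
  · refine ⟨1, ?_⟩
    rw [hT, top_sup_eq, Subgroup.index_top]
    exact Nat.one_le_pow _ _ hp.out.pos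
  · obtain ⟨x, hx⟩ : ∃ x, x ∉ S := by
      by_contra! h
      exact hT ((Subgroup.eq_top_iff' S).2 h)
    refine ⟨x, ?_⟩
    have hlt : S < S ⊔ Subgroup.zpowers x := by
      refine lt_of_le_of_ne le_sup_left fun h => hx ?_
      rw [h]
      exact Subgroup.mem_sup_right (Subgroup.mem_zpowers x)
    have h1 := hG.card_mul_le_of_lt hlt
    have h2 := S.card_mul_index
    have h3 := (S ⊔ Subgroup.zpowers x).card_mul_index
    have h4 : 0 < Nat.card S := Nat.card_pos
    have h5 : Nat.card S * (p * (S ⊔ Subgroup.zpowers x).index) ≤ Nat.card S * p ^ (k + 1) := by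
      calc Nat.card S * (p * (S ⊔ Subgroup.zpowers x).index)
          = Nat.card S * p * (S ⊔ Subgroup.zpowers x).index := by ring
        _ ≤ Nat.card (S ⊔ Subgroup.zpowers x : Subgroup G) * (S ⊔ Subgroup.zpowers x).index :=
            Nat.mul_le_mul_right _ h1
        _ = Nat.card S * S.index := by rw [h2, h3]
        _ ≤ _ := Nat.mul_le_mul_left _ hS
    have h6 := Nat.le_of_mul_le_mul_left h5 h4
    rw [pow_succ'] at h6
    exact Nat.le_of_mul_le_mul_left h6 hp.out.pos

/-- If all three memberships failed, 1 < ⟨c⟩ < ⟨b, c⟩ < S would be a strict chain, forcing |S| ≥ p³.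
-/
theorem IsPGroup.mem_closure_pair_or (hG : IsPGroup p G) {S : Subgroup G}
    (hS : Nat.card S ≤ p ^ 2) {a b c : G} (ha : a ∈ S) (hb : b ∈ S) (hc : c ∈ S) :
    a ∈ Subgroup.closure {b, c} ∨ b ∈ Subgroup.closure {a, c} ∨
      c ∈ Subgroup.closure {a, b} := by
  by_contra! h
  obtain ⟨h1, h2, h3⟩ := h
  have l1 : (⊥ : Subgroup G) < Subgroup.closure {c} := by
    rw [bot_lt_iff_ne_bot, ne_eq, Subgroup.closure_eq_bot_iff]
    intro h
    exact h3 (by rw [h rfl]; exact Subgroup.one_mem _)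
  have l2 : Subgroup.closure {c} < Subgroup.closure {b, c} := by
    refine lt_of_le_of_ne (Subgroup.closure_mono (by simp)) fun h => h2 ?_
    have : b ∈ Subgroup.closure {b, c} := Subgroup.subset_closure (by simp)
    rw [← h] at this
    exact Subgroup.closure_mono (by simp) this
  have l3 : Subgroup.closure {b, c} < S := by
    refine lt_of_le_of_ne ?_ fun h => h1 (h ▸ ha)
    rw [Subgroup.closure_le]
    rintro _ (rfl | rfl)
    · exact hb
    · exact hc
  have m1 := hG.card_mul_le_of_lt l1
  have m2 := hG.card_mul_le_of_lt l2
  have m3 := hG.card_mul_le_of_lt l3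
  rw [Subgroup.card_bot, one_mul] at m1
  have : p * p * p ≤ p ^ 2 :=
    ((Nat.mul_le_mul_right p ((Nat.mul_le_mul_right p m1).trans m2)).trans m3).trans hS
  have hlt : p ^ 2 < p ^ 3 := Nat.pow_lt_pow_right hp.out.one_lt (by norm_num)
  rw [← sq, ← pow_succ] at this
  exact absurd this hlt.not_ge

/-- A `p`-group of class two with elementary abelian abelianization, and small commutator subgroup
and abelianization, has an abelian subgroup of index at most `p` containing the commutator
subgroup. -/
theorem IsPGroup.exists_abelian_index_dvd (hG : IsPGroup p G)
    (hcl : commutator G ≤ Subgroup.center G) (hexp : ∀ x : G, x ^ p ∈ commutator G)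
    (h : (commutator G).index ≤ p ^ 2 ∨
      Nat.card (commutator G) ≤ p ^ 2 ∧ (commutator G).index ≤ p ^ 3) :
    ∃ D : Subgroup G, commutator G ≤ D ∧ (∀ x ∈ D, ∀ y ∈ D, x * y = y * x) ∧ D.index ∣ p := by
  rcases h with h | ⟨hc, h⟩
  · obtain ⟨x, hx⟩ := hG.exists_index_sup_zpowers_le _ h
    obtain ⟨g, hg⟩ := hG.exists_index_sup_zpowers_le (k := 0) _ hx
    have htop : commutator G ⊔ Subgroup.zpowers x ⊔ Subgroup.zpowers g = ⊤ :=
      Subgroup.index_eq_one.1 (le_antisymm (by simpa using hg)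
        (Nat.pos_of_ne_zero Subgroup.index_ne_zero_of_finite))
    -- Two generators suffice modulo G', so the third is taken to be trivial.
    refine exists_abelian_of_commutatorElement_eq hcl hexp (x := x) (y := 1) (g := g) ?_ ?_
    · rw [Subgroup.zpowers_one_eq_bot, sup_bot_eq]
      exact htop
    · rw [commutatorElement_one_right]
      exact Subgroup.one_mem _
  · obtain ⟨x, hx⟩ := hG.exists_index_sup_zpowers_le _ h
    obtain ⟨y, hy⟩ := hG.exists_index_sup_zpowers_le _ hx
    obtain ⟨g, hg⟩ := hG.exists_index_sup_zpowers_le (k := 0) _ hy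
    have htop : commutator G ⊔ Subgroup.zpowers x ⊔ Subgroup.zpowers y ⊔ Subgroup.zpowers g = ⊤ :=
      Subgroup.index_eq_one.1 (le_antisymm (by simpa using hg)
        (Nat.pos_of_ne_zero Subgroup.index_ne_zero_of_finite))
    rcases hG.mem_closure_pair_or hc (commutatorElement_mem_commutator x y)
      (commutatorElement_mem_commutator x g) (commutatorElement_mem_commutator y g) with
      h1 | h1 | h1
    · exact exists_abelian_of_commutatorElement_eq hcl hexp htop h1
    · refine exists_abelian_of_commutatorElement_eq hcl hexp (x := x) (y := g) (g := y) ?_ ?_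
      · rw [← htop, sup_right_comm]
      · refine (Subgroup.closure_le _).2 ?_ h1
        rintro _ (rfl | rfl)
        · exact Subgroup.subset_closure (by simp)
        · rw [SetLike.mem_coe, ← Subgroup.inv_mem_iff, commutatorElement_inv]
          exact Subgroup.subset_closure (by simp)
    · refine exists_abelian_of_commutatorElement_eq hcl hexp (x := y) (y := g) (g := x) ?_ ?_
      · rw [← htop, sup_right_comm, sup_right_comm _ _ (Subgroup.zpowers x)]
      · refine (Subgroup.closure_le _).2 ?_ h1
        rintro _ (rfl | rfl)
        · rw [SetLike.mem_coe, ← Subgroup.inv_mem_iff, commutatorElement_inv]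
          exact Subgroup.subset_closure (by simp)
        · rw [SetLike.mem_coe, ← Subgroup.inv_mem_iff, commutatorElement_inv]
          exact Subgroup.subset_closure (by simp)

end PGroup

/-! ### Orders, indices and centres in quotients -/

section Quotients

variable {G : Type*} [Group G]

theorem normal_of_le_center {N : Subgroup G} (h : N ≤ Subgroup.center G) : N.Normal := by
  rw [← Subgroup.commutator_top_right_le_iff,
    Subgroup.commutator_top_right_eq_bot_iff_le_center.2 h]
  exact bot_le

theorem commutator_quotient (N : Subgroup G) [N.Normal] :
    commutator (G ⧸ N) = (commutator G).map (QuotientGroup.mk' N) := by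
  rw [map_commutator_eq, MonoidHom.range_eq_top.2 (QuotientGroup.mk'_surjective N),
    commutator_def]

theorem index_map_mk'_eq {N H : Subgroup G} [N.Normal] (h : N ≤ H) :
    (H.map (QuotientGroup.mk' N)).index = H.index :=
  Subgroup.index_map_eq H (QuotientGroup.mk'_surjective N) (by rwa [QuotientGroup.ker_mk'])

theorem card_map_mk'_mul [Finite G] {N H : Subgroup G} [N.Normal] (h : N ≤ H) :
    Nat.card (H.map (QuotientGroup.mk' N)) * Nat.card N = Nat.card H := by
  have h1 := (H.map (QuotientGroup.mk' N)).card_mul_index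
  rw [index_map_mk'_eq h] at h1
  have h2 := H.card_mul_index
  have h3 := Subgroup.card_eq_card_quotient_mul_card_subgroup N
  have h4 : 0 < H.index := Nat.pos_of_ne_zero Subgroup.index_ne_zero_of_finite
  refine Nat.eq_of_mul_eq_mul_right h4 ?_
  rw [h2, h3, ← h1]
  ring

theorem mk_mem_map_mk'_iff {N H : Subgroup G} [N.Normal] (h : N ≤ H) {x : G} :
    (x : G ⧸ N) ∈ H.map (QuotientGroup.mk' N) ↔ x ∈ H := by
  refine ⟨?_, fun hx => ⟨x, hx, rfl⟩⟩
  rintro ⟨y, hy, hxy⟩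
  have : y⁻¹ * x ∈ N := QuotientGroup.eq.1 hxy
  simpa using H.mul_mem hy (h this)

theorem mk_mem_center_iff {N : Subgroup G} [N.Normal] {x : G} :
    (x : G ⧸ N) ∈ Subgroup.center (G ⧸ N) ↔ ∀ g : G, ⁅x, g⁆ ∈ N := by
  have key : ∀ g : G, ⁅x, g⁆ ∈ N ↔ (x : G ⧸ N) * g = g * x := fun g => by
    rw [← commutatorElement_eq_one_iff_mul_comm, ← QuotientGroup.eq_one_iff]
    rfl
  rw [Subgroup.mem_center_iff]
  constructor
  · exact fun h g => (key g).2 (h g).symm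
  · intro h q
    obtain ⟨g, rfl⟩ := QuotientGroup.mk_surjective q
    exact ((key g).1 (h g)).symm

end Quotients

/-! ### Quotients with derived subgroup of order p -/

section PGroup

variable {p : ℕ} [hp : Fact p.Prime] {G : Type*} [Group G] [Finite G]

theorem IsPGroup.exists_between_card_mul (hG : IsPGroup p G) {R S : Subgroup G} (h : R < S) :
    ∃ N, R ≤ N ∧ N ≤ S ∧ Nat.card N * p = Nat.card S := by
  obtain ⟨a, ha⟩ := IsPGroup.iff_card.1 (hG.to_subgroup R)
  obtain ⟨b, hb⟩ := IsPGroup.iff_card.1 (hG.to_subgroup S)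
  have hab := hG.card_mul_le_of_lt h
  rw [ha, hb, ← pow_succ, Nat.pow_le_pow_iff_right hp.out.one_lt] at hab
  have hR : Nat.card (R.subgroupOf S) = p ^ a := by
    rw [← ha]
    exact Nat.card_congr (Subgroup.subgroupOfEquivOfLe h.le).toEquiv
  obtain ⟨K, hK, hRK⟩ := Sylow.exists_subgroup_card_pow_prime_le p (m := b - 1)
    (hb ▸ pow_dvd_pow p (by omega)) (R.subgroupOf S) hR (by omega)
  refine ⟨K.map S.subtype, fun x hx => ⟨⟨x, h.le hx⟩, hRK hx, rfl⟩, Subgroup.map_subtype_le K, ?_⟩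
  rw [← Nat.card_congr (K.equivMapOfInjective _ S.subtype_injective).toEquiv, hK, hb, ← pow_succ]
  congr 1
  omega

theorem IsPGroup.sq_le_index_center (hG : IsPGroup p G) (hne : commutator G ≠ ⊥) :
    p ^ 2 ≤ (Subgroup.center G).index := by
  obtain ⟨k, hk⟩ := hG.index (Subgroup.center G)
  rw [hk]
  refine Nat.pow_le_pow_right hp.out.pos ?_
  by_contra hlt
  have hk2 : k < 2 := by omega
  apply hne
  interval_cases k
  · exact (commutator_eq_bot_iff_center_eq_top G).2 (Subgroup.index_eq_one.1 (by simpa using hk))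
  · have : IsCyclic (G ⧸ Subgroup.center G) := isCyclic_of_prime_card (p := p) (hk.trans (pow_one p))
    rw [commutator_eq_bot_iff]
    exact MonoidHom.isMulCommutative_of_isCyclic_of_ker_le_center
      (QuotientGroup.mk' (Subgroup.center G)) (by rw [QuotientGroup.ker_mk'])

theorem IsPGroup.dvd_of_index_le (hG : IsPGroup p G) {H : Subgroup G} (h : H.index ≤ p) :
    H.index ∣ p := by
  obtain ⟨k, hk⟩ := hG.index H
  rw [hk] at h ⊢
  have : k ≤ 1 := (Nat.pow_le_pow_iff_right hp.out.one_lt).1 (by simpa using h)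
  exact (pow_dvd_pow p this).trans (pow_one p).dvd

/-- A `p`-group of class two with an abelian subgroup `D` of index `p` has a character of codegree
`p ^ 2` if `D` contains an element of order `p` outside the commutator subgroup. -/
theorem IsPGroup.sq_mem_codegrees_of_pow_eq_one (hG : IsPGroup p G)
    (hcl : commutator G ≤ Subgroup.center G) (hcard : p < Nat.card (commutator G))
    (hidx : (commutator G).index ≤ p ^ 3) {D : Subgroup G} (hGD : commutator G ≤ D)
    (hD : ∀ x ∈ D, ∀ y ∈ D, x * y = y * x) (hDp : D.index ∣ p) {d : G} (hdD : d ∈ D)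
    (hd : d ∉ commutator G) (hdp : d ^ p = 1) : (p : ℂ) ^ 2 ∈ codegrees G := by
  have hcc : ∀ a x y : G, Commute a ⁅x, y⁆ := fun a x y =>
    Subgroup.mem_center_iff.1 (hcl (commutatorElement_mem_commutator x y)) a
  let ψ : G →* G :=
    { toFun := fun g => ⁅g, d⁆
      map_one' := by simp
      map_mul' := fun a b => by
        rw [commutatorElement_mul_left_of_commute (hcc _ _ _)]
        exact hcc _ _ _ }
  have hψG : ψ.range ≤ commutator G := by
    rintro _ ⟨g, rfl⟩
    exact commutatorElement_mem_commutator _ _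
  -- D centralizes d, so [G, d] has order at most |G : D|.
  have hψcard : Nat.card ψ.range ≤ p := by
    rw [← Subgroup.index_ker]
    refine (Nat.le_of_dvd hp.out.pos ((Subgroup.index_dvd_of_le fun x hx => ?_).trans hDp))
    exact commutatorElement_eq_one_iff_mul_comm.2 (hD x hx d hdD)
  have hlt : ψ.range < commutator G :=
    lt_of_le_of_ne hψG fun h => absurd (h ▸ hψcard) hcard.not_ge
  obtain ⟨N, hRN, hNG, hNcard⟩ := hG.exists_between_card_mul hlt
  have hN : N.Normal := normal_of_le_center (hNG.trans hcl)
  apply codegrees_quotient_subset N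
  have hQ : IsPGroup p (G ⧸ N) := hG.to_quotient N
  have hQcard : Nat.card (commutator (G ⧸ N)) = p := by
    have h := card_map_mk'_mul hNG
    rw [← commutator_quotient, ← hNcard, mul_comm] at h
    exact Nat.eq_of_mul_eq_mul_left Nat.card_pos h
  have hQcl : commutator (G ⧸ N) ≤ Subgroup.center (G ⧸ N) := by
    rw [commutator_quotient]
    rintro _ ⟨x, hx, rfl⟩
    refine mk_mem_center_iff.2 fun g => ?_
    rw [commutatorElement_eq_one_iff_mul_comm.2 (Subgroup.mem_center_iff.1 (hcl hx) g).symm]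
    exact N.one_mem
  have hQidx : (Subgroup.center (G ⧸ N)).index ≤ p ^ 2 := by
    refine index_center_le_sq hp.out (A := D.map (QuotientGroup.mk' N)) ?_ ?_ hQcard.le
    · rintro _ ⟨x, hx, rfl⟩ _ ⟨y, hy, rfl⟩
      rw [← map_mul, ← map_mul, hD x hx y hy]
    · rwa [index_map_mk'_eq (hNG.trans hGD)]
  have hQne : commutator (G ⧸ N) ≠ ⊥ := fun h => by
    rw [h, Subgroup.card_bot] at hQcard
    exact hp.out.one_lt.ne hQcard
  -- The quotient has order at most p · p³ and its centre has index at least p².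
  have hZcard : Nat.card (Subgroup.center (G ⧸ N)) ≤ p ^ 2 := by
    have h1 := (commutator (G ⧸ N)).card_mul_index
    rw [hQcard, commutator_quotient, index_map_mk'_eq hNG] at h1
    have h2 := (Subgroup.center (G ⧸ N)).card_mul_index
    have h3 := hQ.sq_le_index_center hQne
    have h4 : Nat.card (Subgroup.center (G ⧸ N)) * p ^ 2 ≤ p ^ 2 * p ^ 2 := by
      calc _ ≤ Nat.card (Subgroup.center (G ⧸ N)) * (Subgroup.center (G ⧸ N)).index :=
            Nat.mul_le_mul_left _ h3
        _ = p * (commutator G).index := by rw [h2, h1]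
        _ ≤ p * p ^ 3 := Nat.mul_le_mul_left _ hidx
        _ = p ^ 2 * p ^ 2 := by ring
    exact Nat.le_of_mul_le_mul_right h4 (pow_pos hp.out.pos 2)
  -- The central elements of order dividing p. They include the derived subgroup and the image of d
  -- outside it, hence at least p² elements: the whole centre.
  let W : Subgroup (G ⧸ N) :=
    { carrier := {z | z ∈ Subgroup.center (G ⧸ N) ∧ z ^ p = 1}
      mul_mem' := fun {a b} ha hb => ⟨Subgroup.mul_mem _ ha.1 hb.1, by
        have hab : Commute a b := Subgroup.mem_center_iff.1 hb.1 a
        rw [hab.mul_pow, ha.2, hb.2, one_mul]⟩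
      one_mem' := ⟨Subgroup.one_mem _, one_pow p⟩
      inv_mem' := fun {a} ha => ⟨Subgroup.inv_mem _ ha.1, by rw [inv_pow, ha.2, inv_one]⟩ }
  have hWlt : commutator (G ⧸ N) < W := by
    refine lt_of_le_of_ne (fun x hx => ⟨hQcl hx, ?_⟩) fun h => hd ?_
    · have := pow_card_eq_one' (x := (⟨x, hx⟩ : commutator (G ⧸ N)))
      rw [hQcard] at this
      exact congrArg Subtype.val this
    · have hdW : (d : G ⧸ N) ∈ W := by
        refine ⟨mk_mem_center_iff.2 fun g => ?_, ?_⟩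
        · rw [← commutatorElement_inv]
          exact N.inv_mem (hRN ⟨g, rfl⟩)
        · rw [← QuotientGroup.mk_pow, hdp, QuotientGroup.mk_one]
      rw [← h, commutator_quotient] at hdW
      exact (mk_mem_map_mk'_iff hNG).1 hdW
  have hW : W = Subgroup.center (G ⧸ N) := by
    refine Subgroup.eq_of_le_of_card_ge (fun x hx => hx.1) ?_
    have := hQ.card_mul_le_of_lt hWlt
    rw [hQcard, ← sq] at this
    exact hZcard.trans this
  exact sq_mem_codegrees_of_card_commutator_eq hQ hQcard hQcl
    (fun z hz => by rw [← hW] at hz; exact hz.2) hQidx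

/-- A `p`-group of class three whose third lower central term has order `p` has a character of
codegree `p ^ 2` if its abelianization has exponent `p` and the central part of its commutator
subgroup has index `p` there. -/
theorem IsPGroup.sq_mem_codegrees_of_card_inf_center (hG : IsPGroup p G)
    (hexp : ∀ x : G, x ^ p ∈ commutator G)
    (hcen : ⁅commutator G, (⊤ : Subgroup G)⁆ ≤ Subgroup.center G)
    (hthree : Nat.card (⁅commutator G, (⊤ : Subgroup G)⁆ : Subgroup G) = p)
    (hK : Nat.card (commutator G ⊓ Subgroup.center G : Subgroup G) * p = Nat.card (commutator G)) :
    (p : ℂ) ^ 2 ∈ codegrees G := by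
  set K := commutator G ⊓ Subgroup.center G with hKdef
  have hKG : K ≤ commutator G := inf_le_left
  have hKN : K.Normal := normal_of_le_center inf_le_right
  have hgen : ∀ a ∈ commutator G, a ∉ K → K ⊔ Subgroup.zpowers a = commutator G := by
    intro a ha haK
    have hlt : K < K ⊔ Subgroup.zpowers a := by
      refine lt_of_le_of_ne le_sup_left fun h => haK ?_
      rw [h]
      exact Subgroup.mem_sup_right (Subgroup.mem_zpowers a)
    refine Subgroup.eq_of_le_of_card_ge (sup_le hKG (Subgroup.zpowers_le.2 ha)) ?_
    rw [← hK]
    exact hG.card_mul_le_of_lt hlt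
  have hcent : ∀ a ∈ commutator G, a ∉ K → ∀ z, z * a = a * z →
      z ∈ Subgroup.centralizer (commutator G : Set G) := by
    intro a ha haK z hz
    have : commutator G ≤ Subgroup.centralizer {z} := by
      rw [← hgen a ha haK]
      refine sup_le (fun x hx => ?_) (Subgroup.zpowers_le.2 ?_)
      · exact Subgroup.mem_centralizer_singleton_iff.2 (Subgroup.mem_center_iff.1 hx.2 z).symm
      · exact Subgroup.mem_centralizer_singleton_iff.2 hz.symm
    exact Subgroup.mem_centralizer_iff.2 fun h hh =>
      Subgroup.mem_centralizer_singleton_iff.1 (this hh)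
  apply codegrees_quotient_subset K
  have hQ : IsPGroup p (G ⧸ K) := hG.to_quotient K
  have hQcard : Nat.card (commutator (G ⧸ K)) = p := by
    have h := card_map_mk'_mul hKG
    rw [← commutator_quotient, ← hK, mul_comm] at h
    exact Nat.eq_of_mul_eq_mul_left Nat.card_pos h
  have hthreeK : ⁅commutator G, (⊤ : Subgroup G)⁆ ≤ K :=
    le_inf (Subgroup.commutator_le_left _ _) hcen
  refine sq_mem_codegrees_of_card_commutator_eq hQ hQcard ?_ ?_ ?_
  · rw [commutator_quotient]
    rintro _ ⟨x, hx, rfl⟩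
    exact mk_mem_center_iff.2 fun g =>
      hthreeK (Subgroup.commutator_mem_commutator hx (Subgroup.mem_top g))
  · intro q hq
    obtain ⟨z, rfl⟩ := QuotientGroup.mk_surjective q
    rw [mk_mem_center_iff] at hq
    rw [← QuotientGroup.mk_pow, QuotientGroup.eq_one_iff]
    -- Otherwise zᵖ generates G' modulo K, so z centralizes G'. Then [zᵖ, g] = [z, g]ᵖ = [z, gᵖ] =
    -- 1, since gᵖ lies in G', and zᵖ would be central.
    by_contra hzK
    have hzc := hcent _ (hexp z) hzK z (Commute.self_pow z p)
    refine hzK ⟨hexp z, Subgroup.mem_center_iff.2 fun g => ?_⟩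
    have hcc : ∀ a, Commute a ⁅z, g⁆ := Subgroup.mem_center_iff.1 (hq g).2
    refine (commutatorElement_eq_one_iff_mul_comm.1 ?_).symm
    rw [commutatorElement_pow_left (hcc z), ← commutatorElement_pow_right (hcc g),
      commutatorElement_eq_one_iff_mul_comm]
    exact (Subgroup.mem_centralizer_iff.1 hzc _ (hexp g)).symm
  -- The centralizer of G' is abelian modulo K. It coincides with the centralizer of any a in G' \
  -- K, whose index is at most |γ₃| = p.
  · refine index_center_le_sq hp.out (A :=
      (Subgroup.centralizer (commutator G : Set G)).map (QuotientGroup.mk' K)) ?_ ?_ hQcard.le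
    · rintro _ ⟨x, hx, rfl⟩ _ ⟨y, hy, rfl⟩
      rw [← commutatorElement_eq_one_iff_mul_comm, ← map_commutatorElement]
      refine (QuotientGroup.eq_one_iff _).2 ⟨commutatorElement_mem_commutator x y, ?_⟩
      exact commutator_centralizer_commutator_le_center G (Subgroup.commutator_mem_commutator hx hy)
    · rw [index_map_mk'_eq (inf_le_right.trans (Subgroup.center_le_centralizer _))]
      have hlt : ¬ commutator G ≤ K := fun h => by
        have h1 := Subgroup.card_le_of_le h
        have h2 : 0 < Nat.card K := Nat.card_pos
        rw [← hK] at h1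
        nlinarith [hp.out.one_lt]
      obtain ⟨a, ha, haK⟩ := SetLike.not_le_iff_exists.1 hlt
      refine hG.dvd_of_index_le (le_trans ?_ (hthree ▸ index_centralizer_singleton_le a
        ⁅commutator G, (⊤ : Subgroup G)⁆ fun h => ?_))
      · refine Nat.le_of_dvd (Nat.pos_of_ne_zero Subgroup.index_ne_zero_of_finite)
          (Subgroup.index_dvd_of_le fun z hz => ?_)
        exact hcent a ha haK z (Subgroup.mem_centralizer_singleton_iff.1 hz)
      · rw [← commutatorElement_inv]
        exact Subgroup.inv_mem _ (Subgroup.commutator_mem_commutator ha (Subgroup.mem_top h))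

end PGroup

/-! ### Class three with γ₃ of order p -/

section PGroup

variable {p : ℕ} [hp : Fact p.Prime] {G : Type*} [Group G] [Finite G]

/-- If a `p`-group has a subgroup `D` of index `p` that is abelian modulo the third lower central
term, and every element of the commutator subgroup is congruent to the `p`-th power of an element
of `D`, then the central part of the commutator subgroup has index at most `p` there. -/
theorem card_commutator_le_of_exists_pow
    (hcen : ⁅commutator G, (⊤ : Subgroup G)⁆ ≤ Subgroup.center G)
    (hthree : Nat.card (⁅commutator G, (⊤ : Subgroup G)⁆ : Subgroup G) = p)
    {D : Subgroup G} (hidx : D.index = p)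
    (hD : ∀ x ∈ D, ∀ y ∈ D, ⁅x, y⁆ ∈ ⁅commutator G, (⊤ : Subgroup G)⁆)
    (hpow : ∀ h ∈ commutator G, ∃ d ∈ D, (d ^ p)⁻¹ * h ∈ ⁅commutator G, (⊤ : Subgroup G)⁆) :
    Nat.card (commutator G) ≤ Nat.card (commutator G ⊓ Subgroup.center G : Subgroup G) * p := by
  obtain ⟨g, hg⟩ : ∃ g, g ∉ D := by
    by_contra! h
    rw [(Subgroup.eq_top_iff' D).2 h, Subgroup.index_top] at hidx
    exact hp.out.one_lt.ne hidx
  have hDc : ∀ h ∈ commutator G, D ≤ Subgroup.centralizer {h} := by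
    intro h hh e he
    obtain ⟨d, hd, hdh⟩ := hpow h hh
    have hde := hD d hd e he
    have h1 : ⁅d ^ p, e⁆ = 1 := by
      rw [commutatorElement_pow_left (Subgroup.mem_center_iff.1 (hcen hde) d)]
      have := pow_card_eq_one' (x := (⟨_, hde⟩ : (⁅commutator G, (⊤ : Subgroup G)⁆ : Subgroup G)))
      rw [hthree] at this
      exact congrArg Subtype.val this
    have h2 : Commute e (d ^ p) := (commutatorElement_eq_one_iff_commute.1 h1).symm
    have h3 : Commute e ((d ^ p)⁻¹ * h) := Subgroup.mem_center_iff.1 (hcen hdh) e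
    have h4 := h2.mul_right h3
    rw [mul_inv_cancel_left] at h4
    exact Subgroup.mem_centralizer_singleton_iff.2 h4
  let ψ : commutator G →* G :=
    { toFun := fun h => ⁅(h : G), g⁆
      map_one' := by simp
      map_mul' := fun a b => by
        have hb : ⁅(b : G), g⁆ ∈ Subgroup.center G :=
          hcen (Subgroup.commutator_mem_commutator b.2 (Subgroup.mem_top g))
        rw [Subgroup.coe_mul, commutatorElement_mul_left_of_commute
          (Subgroup.mem_center_iff.1 hb a)]
        exact (Subgroup.mem_center_iff.1 hb _).symm }
  have hrange : ψ.range ≤ ⁅commutator G, (⊤ : Subgroup G)⁆ := by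
    rintro _ ⟨h, rfl⟩
    exact Subgroup.commutator_mem_commutator h.2 (Subgroup.mem_top g)
  -- An element of G' killed by [·, g] commutes with g and with the maximal subgroup D, so it is
  -- central.
  have hker : ψ.ker.map (commutator G).subtype ≤ commutator G ⊓ Subgroup.center G := by
    rintro _ ⟨h, hh, rfl⟩
    refine ⟨h.2, ?_⟩
    have hT : Subgroup.centralizer {(h : G)} = ⊤ :=
      eq_top_of_index_prime (hidx ▸ hp.out) (hDc h h.2) (g := g)
        (Subgroup.mem_centralizer_singleton_iff.2
          (commutatorElement_eq_one_iff_mul_comm.1 hh).symm) hg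
    exact Subgroup.mem_center_iff.2 fun y =>
      Subgroup.mem_centralizer_singleton_iff.1 (hT ▸ Subgroup.mem_top y)
  calc Nat.card (commutator G) = Nat.card ψ.ker * Nat.card ψ.range := by
        rw [← ψ.ker.card_mul_index, Subgroup.index_ker]
    _ ≤ _ := by
        refine Nat.mul_le_mul ?_ (hthree ▸ Subgroup.card_le_of_le hrange)
        rw [Nat.card_congr (ψ.ker.equivMapOfInjective _ (commutator G).subtype_injective).toEquiv]
        exact Subgroup.card_le_of_le hker

/-- A `p`-group of class two containing an abelian subgroup of index `p` has commutator subgroup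
consisting of `p`-th powers of elements of `D`, unless `D` has elements of order `p` outside the
commutator subgroup. -/
theorem exists_pow_eq_of_mem_commutator (hcl : commutator G ≤ Subgroup.center G)
    (hexp : ∀ x : G, x ^ p ∈ commutator G) {D : Subgroup G} (hGD : commutator G ≤ D)
    (hD : ∀ x ∈ D, ∀ y ∈ D, x * y = y * x) (hidx : D.index = p)
    (hord : ∀ d ∈ D, d ^ p = 1 → d ∈ commutator G) {h : G} (hh : h ∈ commutator G) :
    ∃ d ∈ D, d ^ p = h := by
  let ψ : D →* G :=
    { toFun := fun d => (d : G) ^ p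
      map_one' := by simp
      map_mul' := fun a b => by
        have hab : Commute (a : G) b := hD a a.2 b b.2
        exact hab.mul_pow p }
  have hrange : ψ.range ≤ commutator G := by
    rintro _ ⟨d, rfl⟩
    exact hexp d
  have hker : ψ.ker.map D.subtype ≤ commutator G := by
    rintro _ ⟨d, hd, rfl⟩
    exact hord d d.2 hd
  have h1 : Nat.card ψ.ker ≤ Nat.card (commutator G) := by
    rw [Nat.card_congr (ψ.ker.equivMapOfInjective _ D.subtype_injective).toEquiv]
    exact Subgroup.card_le_of_le hker
  have h2 := card_commutator_mul_self_le hcl hGD hD (hidx ▸ hp.out)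
  have h3 : Nat.card D = Nat.card ψ.ker * Nat.card ψ.range := by
    rw [← ψ.ker.card_mul_index, Subgroup.index_ker]
  have h4 : Nat.card (commutator G) ≤ Nat.card ψ.range := by
    -- |Q'|² ≤ |D| = |ker| · |image| with |ker| ≤ |Q'| gives |image| ≥ |Q'|, where Q' is the derived
    -- subgroup.
    rw [h3] at h2
    exact Nat.le_of_mul_le_mul_left (h2.trans (Nat.mul_le_mul_right _ h1)) Nat.card_pos
  rw [← Subgroup.eq_of_le_of_card_ge hrange h4] at hh
  obtain ⟨d, rfl⟩ := hh
  exact ⟨d, d.2, rfl⟩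

/-- A `p`-group of class three with third lower central term of order `p` and index at most
`p ^ 5`, and abelianization of exponent `p`, has a character of codegree `p ^ 2`. -/
theorem IsPGroup.sq_mem_codegrees_of_class_three (hG : IsPGroup p G)
    (hexp : ∀ x : G, x ^ p ∈ commutator G)
    (hcen : ⁅commutator G, (⊤ : Subgroup G)⁆ ≤ Subgroup.center G)
    (hthree : Nat.card (⁅commutator G, (⊤ : Subgroup G)⁆ : Subgroup G) = p)
    (hidx : (⁅commutator G, (⊤ : Subgroup G)⁆ : Subgroup G).index ≤ p ^ 5) :
    (p : ℂ) ^ 2 ∈ codegrees G := by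
  set T : Subgroup G := ⁅commutator G, (⊤ : Subgroup G)⁆ with hT
  set K := commutator G ⊓ Subgroup.center G with hKdef
  have hTG : T ≤ commutator G := Subgroup.commutator_le_left _ _
  by_cases hK : Nat.card K * p = Nat.card (commutator G)
  · exact hG.sq_mem_codegrees_of_card_inf_center hexp hcen hthree hK
  have hKlt : K < commutator G := by
    refine lt_of_le_of_ne inf_le_left fun h => ?_
    have h1 : commutator G ≤ Subgroup.center G := h ▸ inf_le_right
    rw [hT, Subgroup.commutator_top_right_eq_bot_iff_le_center.2 h1, Subgroup.card_bot] at hthree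
    exact hp.out.one_lt.ne hthree
  have hTK : T ≤ K := le_inf hTG hcen
  have hTN : T.Normal := inferInstance
  have hQ : IsPGroup p (G ⧸ T) := hG.to_quotient T
  have hQcl : commutator (G ⧸ T) ≤ Subgroup.center (G ⧸ T) := by
    rw [commutator_quotient]
    rintro _ ⟨x, hx, rfl⟩
    exact mk_mem_center_iff.2 fun g =>
      Subgroup.commutator_mem_commutator hx (Subgroup.mem_top g)
  have hQexp : ∀ x : G ⧸ T, x ^ p ∈ commutator (G ⧸ T) := by
    intro q
    obtain ⟨x, rfl⟩ := QuotientGroup.mk_surjective q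
    rw [commutator_quotient]
    exact ⟨x ^ p, hexp x, rfl⟩
  have hQcard : Nat.card (commutator (G ⧸ T)) * p = Nat.card (commutator G) := by
    rw [commutator_quotient, ← hthree]
    exact card_map_mk'_mul hTG
  have hplt : p < Nat.card (commutator (G ⧸ T)) := by
    have h1 := lt_of_le_of_ne (hG.card_mul_le_of_lt hKlt) hK
    have h2 : p ≤ Nat.card K := hthree ▸ Subgroup.card_le_of_le hTK
    rw [← hQcard] at h1
    exact h2.trans_lt (lt_of_mul_lt_mul_right h1 (Nat.zero_le p))
  obtain ⟨a, ha⟩ := IsPGroup.iff_card.1 (hQ.to_subgroup (commutator (G ⧸ T)))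
  obtain ⟨b, hb⟩ := hQ.index (commutator (G ⧸ T))
  have hab : a + b ≤ 5 := by
    have h := (commutator (G ⧸ T)).card_mul_index
    rw [ha, hb, ← pow_add] at h
    have h' : p ^ (a + b) ≤ p ^ 5 := h.trans_le hidx
    exact (Nat.pow_le_pow_iff_right hp.out.one_lt).1 h'
  have ha2 : 2 ≤ a := by
    rw [ha] at hplt
    have : p ^ 1 < p ^ a := by simpa using hplt
    exact (Nat.pow_lt_pow_iff_right hp.out.one_lt).1 this
  have hidx3 : (commutator (G ⧸ T)).index ≤ p ^ 3 :=
    hb ▸ Nat.pow_le_pow_right hp.out.pos (by omega)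
  -- From 2 ≤ a and a + b ≤ 5: either a = 2 and b ≤ 3, or b ≤ 2.
  obtain ⟨D, hGD, hD, hDp⟩ := hQ.exists_abelian_index_dvd hQcl hQexp (by
    rw [ha, hb]
    by_cases h2 : a = 2
    · exact Or.inr ⟨h2 ▸ le_rfl, Nat.pow_le_pow_right hp.out.pos (by omega)⟩
    · exact Or.inl (Nat.pow_le_pow_right hp.out.pos (by omega)))
  by_cases hord : ∀ d ∈ D, d ^ p = 1 → d ∈ commutator (G ⧸ T)
  · exfalso
    have hDidx : D.index = p := by
      refine ((Nat.dvd_prime hp.out).1 hDp).resolve_left fun h1 => ?_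
      rw [Subgroup.index_eq_one] at h1
      have : commutator (G ⧸ T) = ⊥ := by
        rw [commutator_def, Subgroup.commutator_eq_bot_iff_le_centralizer]
        intro x _
        exact Subgroup.mem_centralizer_iff.2 fun y _ =>
          hD y (h1 ▸ Subgroup.mem_top y) x (h1 ▸ Subgroup.mem_top x)
      rw [this, Subgroup.card_bot] at hplt
      exact absurd hplt hp.out.one_lt.le.not_gt
    have hle := card_commutator_le_of_exists_pow (p := p) hcen hthree
      (D := D.comap (QuotientGroup.mk' T))
      ((Subgroup.index_comap_of_surjective _ (QuotientGroup.mk'_surjective T)).trans hDidx)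
      (fun x hx y hy => by
        rw [← QuotientGroup.eq_one_iff]
        exact commutatorElement_eq_one_iff_mul_comm.2 (hD _ hx _ hy))
      (fun h hh => by
        have hh' : (h : G ⧸ T) ∈ commutator (G ⧸ T) := by
          rw [commutator_quotient]
          exact ⟨h, hh, rfl⟩
        obtain ⟨q, hq, hqh⟩ := exists_pow_eq_of_mem_commutator hQcl hQexp hGD hD hDidx hord hh'
        obtain ⟨d, rfl⟩ := QuotientGroup.mk_surjective q
        exact ⟨d, hq, QuotientGroup.eq.1 hqh⟩)
    exact hK (le_antisymm (hG.card_mul_le_of_lt hKlt) hle)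
  · push Not at hord
    obtain ⟨d, hdD, hdp, hd⟩ := hord
    exact codegrees_quotient_subset T
      (hQ.sq_mem_codegrees_of_pow_eq_one hQcl hplt hidx3 hGD hD hDp hdD hd hdp)

/-! ### The lower central series and the reduction to class three -/

theorem IsPGroup.pow_le_card_lowerCentralSeries (hG : IsPGroup p G) {j : ℕ}
    (hj : j ≤ Group.nilpotencyClass G) :
    p ^ j ≤ Nat.card ((⊤ : Subgroup G).lowerCentralSeries (Group.nilpotencyClass G - j)) := by
  have hnil : Group.IsNilpotent G := hG.isNilpotent
  induction j with
  | zero => simp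
  | succ j ih =>
    set c := Group.nilpotencyClass G with hc
    have heq : c - j = (c - (j + 1)) + 1 := by omega
    set m := c - (j + 1) with hm
    have hlt : (⊤ : Subgroup G).lowerCentralSeries (m + 1) <
        (⊤ : Subgroup G).lowerCentralSeries m := by
      -- Once two consecutive terms agree the series is constant, hence already trivial, before step
      -- c.
      refine lt_of_le_of_ne (Subgroup.lowerCentralSeries_antitone _ (Nat.le_succ m)) fun h => ?_
      have hconst : ∀ k, (⊤ : Subgroup G).lowerCentralSeries (m + k) =
          (⊤ : Subgroup G).lowerCentralSeries m := by
        intro k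
        induction k with
        | zero => rfl
        | succ k ihk =>
          rw [← add_assoc, Subgroup.lowerCentralSeries_succ, ihk,
            ← Subgroup.lowerCentralSeries_succ, h]
      have hbot : (⊤ : Subgroup G).lowerCentralSeries m = ⊥ := by
        rw [← hconst (c - m), Nat.add_sub_cancel' (by omega)]
        exact Subgroup.lowerCentralSeries_eq_bot_iff_nilpotencyClass_le.2 le_rfl
      have := Subgroup.lowerCentralSeries_eq_bot_iff_nilpotencyClass_le.1 hbot
      omega
    have h1 := hG.card_mul_le_of_lt hlt
    rw [← heq] at h1
    rw [pow_succ]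
    exact (Nat.mul_le_mul_right p (ih (by omega))).trans h1

/-- A finite `p`-group of coclass at most three and class at least three has a character of
codegree `p ^ 2`. -/
theorem IsPGroup.sq_mem_codegrees_of_card (hG : IsPGroup p G) {n : ℕ} (hn : Nat.card G = p ^ n)
    (hc : 3 ≤ Group.nilpotencyClass G) (hco : n ≤ Group.nilpotencyClass G + 3) :
    (p : ℂ) ^ 2 ∈ codegrees G := by
  have hnil : Group.IsNilpotent G := hG.isNilpotent
  by_cases hexp : ∀ x : G, x ^ p ∈ commutator G
  swap
  · push Not at hexp
    obtain ⟨x, hx⟩ := hexp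
    exact sq_mem_codegrees_of_pow_notMem_commutator hG hx
  set T : Subgroup G := ⁅commutator G, (⊤ : Subgroup G)⁆ with hT
  -- The series is indexed from 0, so term 2 is γ₃ and has order at least p^(c - 2).
  have hTl : (⊤ : Subgroup G).lowerCentralSeries 2 = T := by
    rw [Subgroup.lowerCentralSeries_succ, Subgroup.top_lowerCentralSeries_one]
  have hidx : T.index ≤ p ^ 5 := by
    have h1 := hG.pow_le_card_lowerCentralSeries (j := Group.nilpotencyClass G - 2) (by omega)
    rw [Nat.sub_sub_self (by omega), hTl] at h1
    have h2 := T.card_mul_index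
    have h3 : p ^ (Group.nilpotencyClass G - 2) * T.index ≤
        p ^ (Group.nilpotencyClass G - 2) * p ^ 5 := by
      calc _ ≤ Nat.card T * T.index := Nat.mul_le_mul_right _ h1
        _ = p ^ n := by rw [h2, hn]
        _ ≤ p ^ (Group.nilpotencyClass G - 2 + 5) :=
            Nat.pow_le_pow_right hp.out.pos (by omega)
        _ = _ := pow_add _ _ _
    exact Nat.le_of_mul_le_mul_left h3 (pow_pos hp.out.pos _)
  have hTlt : ⁅T, (⊤ : Subgroup G)⁆ < T := by
    refine lt_of_le_of_ne (Subgroup.commutator_le_left _ _) fun h => ?_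
    have hconst : ∀ k, (⊤ : Subgroup G).lowerCentralSeries (2 + k) = T := by
      intro k
      induction k with
      | zero => exact hTl
      | succ k ih => rw [← add_assoc, Subgroup.lowerCentralSeries_succ, ih, h]
    have h2 := hconst (Group.nilpotencyClass G - 2)
    rw [Nat.add_sub_cancel' (by omega), Subgroup.lowerCentralSeries_nilpotencyClass, ← hTl,
      eq_comm, Subgroup.lowerCentralSeries_eq_bot_iff_nilpotencyClass_le] at h2
    omega
  obtain ⟨L, hL4, hLT, hLcard⟩ := hG.exists_between_card_mul hTlt
  have hLN : L.Normal := by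
    rw [← Subgroup.commutator_top_right_le_iff]
    exact (Subgroup.commutator_mono hLT le_rfl).trans hL4
  have hmap : (⁅commutator (G ⧸ L), (⊤ : Subgroup (G ⧸ L))⁆ : Subgroup (G ⧸ L)) =
      T.map (QuotientGroup.mk' L) := by
    rw [hT, Subgroup.map_commutator, commutator_quotient, ← MonoidHom.range_eq_map,
      MonoidHom.range_eq_top.2 (QuotientGroup.mk'_surjective L)]
  apply codegrees_quotient_subset L
  refine (hG.to_quotient L).sq_mem_codegrees_of_class_three ?_ ?_ ?_ ?_
  · intro q
    obtain ⟨x, rfl⟩ := QuotientGroup.mk_surjective q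
    rw [commutator_quotient]
    exact ⟨x ^ p, hexp x, rfl⟩
  · rw [hmap]
    rintro _ ⟨x, hx, rfl⟩
    exact mk_mem_center_iff.2 fun g =>
      hL4 (Subgroup.commutator_mem_commutator hx (Subgroup.mem_top g))
  · have h := card_map_mk'_mul hLT
    rw [hmap]
    rw [← hLcard, mul_comm] at h
    exact Nat.eq_of_mul_eq_mul_left Nat.card_pos h
  · rw [hmap, index_map_mk'_eq hLT]
    exact hidx

end PGroup

theorem theorem1 (p : ℕ) [Fact p.Prime] (G : Type*) [Group G] [Finite G] (hG : IsPGroup p G) :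
    (coclass p G = 2 → p ^ 5 ≤ Nat.card G → (p : ℂ) ^ 2 ∈ codegrees G) ∧
    (coclass p G = 3 → p ^ 6 ≤ Nat.card G → (p : ℂ) ^ 2 ∈ codegrees G) := by
  have hp : p.Prime := Fact.out
  obtain ⟨n, hn⟩ := IsPGroup.iff_card.1 hG
  have hlog : Nat.log p (Nat.card G) = n := by rw [hn, Nat.log_pow hp.one_lt]
  have hle : ∀ k, p ^ k ≤ Nat.card G → k ≤ n := fun k hk =>
    (Nat.pow_le_pow_iff_right hp.one_lt).1 (hn ▸ hk)
  simp only [coclass, hlog]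
  -- Both size bounds say exactly that the class is at least 3: 5 - 2 = 6 - 3.
  constructor <;> intro hco hcard <;> have := hle _ hcard <;>
    exact hG.sq_mem_codegrees_of_card hn (by omega) (by omega)
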